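/- A vertex colouring $\psi$ of a finite simple graph is nonrepetitive if there is no path $(v_1,\dots,v_{2t})$, $t\ge 1$, with $\psi(v_i)=\psi(v_{t+i})$ for all $1\le i\le t$; $\pi(G)$ denotes the least $k$ such that $G$ has a nonrepetitive colouring with $k$ colours. For a finite graph $H$ let $G_H$ be the graph that consists of a path $v_1,\dots,v_{22}$, two adjacent vertices $x$ and $y$ that are both adjacent to every $v_i$, and pairwise disjoint copies $H_1,\dots,H_{22}$ of $H$ such that $v_i$ is adjacent to every vertex of $H_i$ for each $i$ (and no other edges). Then there is a finite outerplanar graph $H$ with $\pi(H)\ge 7$ such that $G_H$ is planar and $\pi(G_H)\ge 11$; in particular, there is a planar graph $G$ with $\pi(G)\ge 11$. Moreover, $\pi(G_H)\ge 11$ for every finite graph $H$ with $\pi(H)\ge 7$. -/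

import Mathlib

namespace Nonrepetitive

variable {V : Type*}

/-- A vertex colouring `ψ` of `G` is nonrepetitive if no path `(v₁, …, v₂ₜ)` of even order satisfies
`ψ vᵢ = ψ vₜ₊ᵢ` for all `i`. A path with `p.length` edges has order `p.length + 1`, so `t ≥ 1`;
vertices are indexed from `0` here. -/
def IsNonrepetitive {α : Type*} (G : SimpleGraph V) (ψ : V → α) : Prop :=
  ∀ (u v : V) (p : G.Walk u v) (t : ℕ), p.IsPath → p.length + 1 = 2 * t →
    ¬ ∀ i < t, ψ (p.getVert i) = ψ (p.getVert (t + i))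

/-- The nonrepetitive chromatic number: the least `k` such that `G` has a nonrepetitive
`k`-colouring (and `⊤` if there is no such `k`, which cannot happen for a finite graph). -/
noncomputable def nonrepChromaticNumber (G : SimpleGraph V) : ℕ∞ :=
  ⨅ k ∈ {k : ℕ | ∃ ψ : V → Fin k, IsNonrepetitive G ψ}, (k : ℕ∞)

/-- The Euclidean plane. -/
abbrev Plane : Type := EuclideanSpace ℝ (Fin 2)

/-- A drawing of `G` in the plane without crossings: vertices are distinct points, every edge is a
simple arc joining its two ends, an arc meets vertices only at its two ends, and distinct arcs meet
only at vertices. -/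
structure PlaneDrawing (G : SimpleGraph V) where
  point : V → Plane
  arc : G.edgeSet → C(unitInterval, Plane)
  point_injective : Function.Injective point
  arc_injective : ∀ e, Function.Injective (arc e)
  arc_ends : ∀ e : G.edgeSet, s(arc e 0, arc e 1) = (e : Sym2 V).map point
  arc_vertex : ∀ e v t, arc e t = point v → t = 0 ∨ t = 1
  arc_disjoint : ∀ e f, e ≠ f → ∀ s t, arc e s = arc f t → ∃ v, arc e s = point v

/-- The set of points of the plane that are covered by the drawing. -/
def PlaneDrawing.carrier {G : SimpleGraph V} (D : PlaneDrawing G) : Set Plane :=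
  Set.range D.point ∪ ⋃ e, Set.range (D.arc e)

/-- The outer face of a drawing (of a finite graph): the unbounded connected component of the
complement of the drawing. -/
def PlaneDrawing.outerFace {G : SimpleGraph V} (D : PlaneDrawing G) : Set Plane :=
  {x | x ∈ D.carrierᶜ ∧ ¬ Bornology.IsBounded (connectedComponentIn D.carrierᶜ x)}

/-- A (finite) graph is planar if it has a drawing in the plane without crossings. -/
def IsPlanar (G : SimpleGraph V) : Prop := Nonempty (PlaneDrawing G)

/-- A (finite) graph is outerplanar if it has a drawing in the plane without crossings
in which every vertex lies on the boundary of the outer face. -/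
def IsOuterplanar (G : SimpleGraph V) : Prop :=
  ∃ D : PlaneDrawing G, ∀ v, D.point v ∈ frontier D.outerFace

/-- Vertices of the graph built from `H` (with vertex type `W`): the vertices of a path on `22`
vertices, two dominating vertices `x` and `y`, and `22` copies of the vertices of `H`. -/
inductive OchemVertex (W : Type*) where
  | path (i : Fin 22)
  | x
  | y
  | copy (i : Fin 22) (w : W)

/-- Each pair of adjacent vertices is listed in one or both orders. -/
inductive OchemRel {W : Type*} (H : SimpleGraph W) : OchemVertex W → OchemVertex W → Prop where
  | path_path {i j : Fin 22} : (SimpleGraph.pathGraph 22).Adj i j → OchemRel H (.path i) (.path j)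
  | x_y : OchemRel H .x .y
  | x_path (i : Fin 22) : OchemRel H .x (.path i)
  | y_path (i : Fin 22) : OchemRel H .y (.path i)
  | path_copy (i : Fin 22) (w : W) : OchemRel H (.path i) (.copy i w)
  | copy_copy (i : Fin 22) {w w' : W} : H.Adj w w' → OchemRel H (.copy i w) (.copy i w')

/-- A path `v₁, …, v₂₂`, two adjacent vertices `x`, `y` that are both adjacent to every `vᵢ`, and,
for each `i`, a copy of `H` all of whose vertices are adjacent to `vᵢ`. -/
def ochemGraph {W : Type*} (H : SimpleGraph W) : SimpleGraph (OchemVertex W) :=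
  SimpleGraph.fromRel (OchemRel H)

end Nonrepetitive

/-! The graph `H` is a finite piece of `siblingTree`: each vertex has infinitely many children,
joined in a path. Suppose this tree has a nonrepetitive 6-colouring. The children of a vertex form a
square-free sequence, so at least three colours recur (occur infinitely often) below it. Short
forbidden paths exclude its own colour, its parent's colour if its own recurs among its siblings,
and mutual recurrence between adjacent siblings. Once three colours are excluded, `recurs_of_not`
says that the other three all recur.

The resulting configuration, `Obstruction`, reproduces itself two levels further down with its
colours permuted (`Obstruction.step`). Along the descent the emitted pairs of colours have period
four, so eight steps trace a square of length 16. Either an obstruction occurs near the root, or the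
root starts a descending path coloured `A B C A B C`. Compactness then yields a finite induced
subgraph without a nonrepetitive 6-colouring. Preorder embeds it on one page, which makes it
outerplanar and `ochemGraph H` two-page embeddable, hence planar.

For ten colours on `ochemGraph H`: if `v_i` shares its colour with another `v_j`, then `H_i` must
use exactly the seven colours other than those of `x`, `y`, `v_i`. Two consecutive such path
vertices would give a square through their copies, so each of the eleven disjoint consecutive pairs
contributes a colour that is unique on the path, one too many. -/

namespace Nonrepetitive

open Filter

/-! ### Repetitions as pairs of lists -/

section ListForm

variable {V α : Type*} {G : SimpleGraph V} {ψ : V → α}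

/-- Lets later arguments exhibit a repetition as its two halves `A` and `B` instead of an indexed
walk. -/
theorem IsNonrepetitive.false_of_lists (h : IsNonrepetitive G ψ) {A B : List V} (hA : A ≠ [])
    (hc : A.map ψ = B.map ψ) (hch : (A ++ B).IsChain G.Adj) (hnd : (A ++ B).Nodup) : False := by
  have hlen : A.length = B.length := by simpa using congrArg List.length hc
  have hne : A ++ B ≠ [] := by simp [hA]
  have hpos : 0 < A.length := List.length_pos_iff.2 hA
  refine h _ _ (SimpleGraph.Walk.ofSupport (A ++ B) hne hch) A.length ?_ ?_ ?_
  · rw [SimpleGraph.Walk.isPath_def, SimpleGraph.Walk.support_ofSupport]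
    exact hnd
  · rw [SimpleGraph.Walk.length_ofSupport, List.length_append]
    omega
  · intro i hi
    rw [SimpleGraph.Walk.getVert_eq_support_getElem _ (by
        rw [SimpleGraph.Walk.length_ofSupport, List.length_append]; omega),
      SimpleGraph.Walk.getVert_eq_support_getElem _ (by
        rw [SimpleGraph.Walk.length_ofSupport, List.length_append]; omega)]
    simp only [SimpleGraph.Walk.support_ofSupport]
    rw [List.getElem_append_left hi, List.getElem_append_right (by omega)]
    have h1 : (A.map ψ)[i]'(by simpa using hi) = (B.map ψ)[i]'(by simp; omega) := by
      simp only [hc]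
    simpa using h1

theorem isNonrepetitive_of_lists
    (h : ∀ A B : List V, A ≠ [] → A.map ψ = B.map ψ → (A ++ B).IsChain G.Adj →
      (A ++ B).Nodup → False) : IsNonrepetitive G ψ := by
  intro u v p t hp hlen hrep
  have hl : p.support.length = 2 * t := by rw [SimpleGraph.Walk.length_support, hlen]
  refine h (p.support.take t) (p.support.drop t) ?_ ?_ ?_ ?_
  · intro h0
    have := congrArg List.length h0
    simp at this
    omega
  · apply List.ext_getElem
    · simp
      omega
    · intro i h1 h2
      simp only [List.length_map, List.length_take, List.length_drop] at h1 h2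
      have := hrep i (by omega)
      rw [SimpleGraph.Walk.getVert_eq_support_getElem _ (by omega),
        SimpleGraph.Walk.getVert_eq_support_getElem _ (by omega)] at this
      simpa using this
  · rw [List.take_append_drop]
    exact p.isChain_adj_support
  · rw [List.take_append_drop]
    exact (SimpleGraph.Walk.isPath_def p).1 hp

theorem IsNonrepetitive.comp_injective {β : Type*} {f : α → β} (h : IsNonrepetitive G ψ)
    (hf : Function.Injective f) : IsNonrepetitive G (f ∘ ψ) :=
  fun u v p t hp hl hr ↦ h u v p t hp hl fun i hi ↦ hf (hr i hi)

theorem le_nonrepChromaticNumber {k : ℕ}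
    (h : ∀ ψ : V → Fin k, ¬ IsNonrepetitive G ψ) :
    ((k + 1 : ℕ) : ℕ∞) ≤ nonrepChromaticNumber G := by
  refine le_iInf₂ fun m ⟨ψ, hψ⟩ ↦ ?_
  by_contra hlt
  have hmk : m ≤ k := by
    have : (m : ℕ∞) < ((k + 1 : ℕ) : ℕ∞) := not_le.1 hlt
    have := Nat.cast_lt.1 this
    omega
  exact h _ (hψ.comp_injective (Fin.castLE_injective hmk))

theorem not_isNonrepetitive_of_lt {k : ℕ} (h : ((k + 1 : ℕ) : ℕ∞) ≤ nonrepChromaticNumber G)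
    (ψ : V → Fin k) : ¬ IsNonrepetitive G ψ := by
  intro hψ
  have h1 : nonrepChromaticNumber G ≤ (k : ℕ∞) := iInf₂_le k ⟨ψ, hψ⟩
  have := Nat.cast_le.1 (h.trans h1)
  omega

/-- A nonrepetitive colouring uses at least as many colours as the nonrepetitive chromatic number. -/
theorem lt_card_image_of_lt [Fintype V] [DecidableEq α] {k : ℕ}
    (h : ((k + 1 : ℕ) : ℕ∞) ≤ nonrepChromaticNumber G) (hψ : IsNonrepetitive G ψ) :
    k < (Finset.univ.image ψ).card := by
  by_contra hle
  push Not at hle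
  let s := Finset.univ.image ψ
  let φ : V → s := fun v ↦ ⟨ψ v, Finset.mem_image_of_mem _ (Finset.mem_univ _)⟩
  have hφ : IsNonrepetitive G φ := fun u v p t hp hl hr ↦
    hψ u v p t hp hl fun i hi ↦ congrArg Subtype.val (hr i hi)
  exact not_isNonrepetitive_of_lt h _
    (hφ.comp_injective ((Fin.castLE_injective hle).comp s.equivFin.injective))

end ListForm

/-! ### Reduction to finite induced subgraphs -/

section Compactness

variable {V : Type*} [LinearOrder V] {G : SimpleGraph V}

/-- Compactness: if no finite induced subgraph obstructs nonrepetitive `k`-colourings, then the whole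
graph has one. -/
theorem exists_finset_not_isNonrepetitive {k : ℕ} (hk : 0 < k)
    (h : ∀ ψ : V → Fin k, ¬ IsNonrepetitive G ψ) :
    ∃ s : Finset V, ∀ ψ : Fin s.card → Fin k,
      ¬ IsNonrepetitive (G.comap (s.orderEmbOfFin rfl)) ψ := by
  classical
  by_contra! hcon
  choose c hc using hcon
  -- The default colour outside `s` is harmless: in the limit `s` contains any prescribed finite
  -- path.
  let d : Finset V → V → Fin k := fun s v ↦
    if hv : v ∈ s then c s ((s.orderIsoOfFin rfl).symm ⟨v, hv⟩) else ⟨0, hk⟩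
  -- Along an ultrafilter finer than `atTop` the colour of each vertex is eventually constant, which
  -- defines the limit colouring `ψ`.
  let U : Ultrafilter (Finset V) := Ultrafilter.of atTop
  have hU : (U : Filter (Finset V)) ≤ atTop := Ultrafilter.of_le _
  have hlim : ∀ v, ∃ x, ∀ᶠ s in (U : Filter (Finset V)), d s v = x := by
    intro v
    have : ∀ᶠ s in (U : Filter (Finset V)), ∃ x ∈ (Set.univ : Set (Fin k)), d s v = x :=
      Eventually.of_forall fun s ↦ ⟨_, Set.mem_univ _, rfl⟩
    rw [Ultrafilter.eventually_exists_mem_iff Set.finite_univ] at this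
    obtain ⟨x, -, hx⟩ := this
    exact ⟨x, hx⟩
  choose ψ hψ using hlim
  refine h ψ (isNonrepetitive_of_lists fun A B hA hAB hch hnd ↦ ?_)
  have h1 : ∀ᶠ s in (U : Filter (Finset V)), ∀ v ∈ (A ++ B).toFinset, d s v = ψ v :=
    (Finset.eventually_all _).2 fun v _ ↦ hψ v
  have h2 : ∀ᶠ s in (U : Filter (Finset V)), (A ++ B).toFinset ⊆ s :=
    hU (eventually_ge_atTop _)
  obtain ⟨s, hs1, hs2⟩ := (h1.and h2).exists
  have hlift : ∀ l : List V, (∀ v ∈ l, v ∈ s) →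
      ∃ l' : List (Fin s.card), l'.map (s.orderEmbOfFin rfl) = l := by
    intro l hl
    have : l ∈ Set.range (List.map (s.orderEmbOfFin rfl)) := by
      rw [Set.range_list_map]
      intro v hv
      rw [Finset.range_orderEmbOfFin]
      exact hl v hv
    exact this
  obtain ⟨A', rfl⟩ := hlift A fun v hv ↦ hs2 (by simp [hv])
  obtain ⟨B', rfl⟩ := hlift B fun v hv ↦ hs2 (by simp [hv])
  have hd : ∀ i : Fin s.card, d s (s.orderEmbOfFin rfl i) = c s i := by
    intro i
    have hi : s.orderEmbOfFin rfl i ∈ s := Finset.orderEmbOfFin_mem _ _ _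
    simp only [d, hi, dif_pos]
    congr 1
    rw [OrderIso.symm_apply_eq]
    rfl
  have hcol : ∀ i, s.orderEmbOfFin rfl i ∈ (A'.map (s.orderEmbOfFin rfl) ++
      B'.map (s.orderEmbOfFin rfl)).toFinset → ψ (s.orderEmbOfFin rfl i) = c s i := by
    intro i hi
    rw [← hs1 _ hi, hd]
  refine (hc s).false_of_lists (A := A') (B := B') (by simpa using hA) ?_ ?_ ?_
  · rw [List.map_map, List.map_map] at hAB
    rw [List.map_congr_left (g := ψ ∘ s.orderEmbOfFin rfl) (l := A'),
      List.map_congr_left (g := ψ ∘ s.orderEmbOfFin rfl) (l := B'), hAB]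
    · intro i hi
      exact (hcol i (by simp [hi])).symm
    · intro i hi
      exact (hcol i (by simp [hi])).symm
  · rw [← List.map_append, List.isChain_map] at hch
    exact hch
  · rw [← List.map_append] at hnd
    exact hnd.of_map _

end Compactness

/-! ### Square-free sequences over three letters -/

section Words

variable {α : Type*}

/-- A sequence without two equal consecutive blocks. -/
def SquareFreeSeq (f : ℕ → α) : Prop :=
  ∀ m t, 0 < t → ¬ ∀ i < t, f (m + i) = f (m + t + i)

theorem SquareFreeSeq.shift {f : ℕ → α} (hf : SquareFreeSeq f) (n : ℕ) :
    SquareFreeSeq fun k ↦ f (n + k) := by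
  intro m t ht h
  exact hf (n + m) t ht fun i hi ↦ by simpa only [add_assoc] using h i hi

theorem SquareFreeSeq.succ_ne {f : ℕ → α} (hf : SquareFreeSeq f) (m : ℕ) : f m ≠ f (m + 1) := by
  intro h
  refine hf m 1 one_pos fun i hi ↦ ?_
  obtain rfl : i = 0 := by omega
  exact h

theorem SquareFreeSeq.not_two {f : ℕ → α} (hf : SquareFreeSeq f) (m : ℕ) :
    ¬ (f m = f (m + 2) ∧ f (m + 1) = f (m + 3)) := by
  rintro ⟨h1, h2⟩
  refine hf m 2 two_pos fun i hi ↦ ?_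
  interval_cases i
  · exact h1
  · exact h2

/-- Every word of length four over two letters contains a square. -/
theorem SquareFreeSeq.exists_third {f : ℕ → α} (hf : SquareFreeSeq f) (m : ℕ) (x y : α) :
    ∃ k ≥ m, f k ≠ x ∧ f k ≠ y := by
  by_contra! h
  have h0 := hf.succ_ne m
  have h1 := hf.succ_ne (m + 1)
  have h2 := hf.succ_ne (m + 2)
  have := hf.not_two m
  have k0 := or_iff_not_imp_left.2 (h m (by omega))
  have k1 := or_iff_not_imp_left.2 (h (m + 1) (by omega))
  have k2 := or_iff_not_imp_left.2 (h (m + 2) (by omega))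
  have k3 := or_iff_not_imp_left.2 (h (m + 3) (by omega))
  grind

/-- If `x` and `y` were never adjacent, every second letter would be `z`, and square-freeness would
make the letters in between alternate, giving the square `zxzy zxzy`. -/
theorem SquareFreeSeq.exists_adjacent {f : ℕ → α} (hf : SquareFreeSeq f) (m : ℕ) {x y z : α}
    (h : ∀ k ≥ m, f k = x ∨ f k = y ∨ f k = z) :
    ∃ k ≥ m, (f k = x ∧ f (k + 1) = y) ∨ (f k = y ∧ f (k + 1) = x) := by
  by_contra! hcon
  have key : ∀ k ≥ m, f k = z → f (k + 2) = z ∧ f (k + 1) = f (k + 5) := by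
    intro k hk hz
    have hs : ∀ i, f (k + i) = x ∨ f (k + i) = y ∨ f (k + i) = z := fun i ↦ h _ (by omega)
    have hn : ∀ i, f (k + i) ≠ f (k + i + 1) := fun i ↦ hf.succ_ne _
    have hq : ∀ i, ¬ (f (k + i) = x ∧ f (k + i + 1) = y) ∧ ¬ (f (k + i) = y ∧ f (k + i + 1) = x) :=
      fun i ↦ ⟨fun hh ↦ (hcon (k + i) (by omega)).1 hh.1 hh.2,
        fun hh ↦ (hcon (k + i) (by omega)).2 hh.1 hh.2⟩
    have e2 : ∀ i, f (k + i) = z → f (k + i + 2) = z := by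
      intro i hi
      have a1 := hn i
      have a2 := hn (i + 1)
      have b1 := hs (i + 1)
      have b2 := hs (i + 2)
      have c1 := hq (i + 1)
      simp only [← add_assoc] at *
      grind
    have z2 := e2 0 hz
    have z4 := e2 2 z2
    refine ⟨z2, ?_⟩
    have s0 := hf.not_two k
    have s2 := hf.not_two (k + 2)
    have a1 := hn 0
    have a3 := hn 2
    have a5 := hn 4
    have b1 := hs 1
    have b3 := hs 3
    have b5 := hs 5
    simp only [add_assoc] at *
    norm_num at *
    grind
  obtain ⟨k, hk, hz⟩ : ∃ k ≥ m, f k = z := by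
    obtain ⟨k, hk, h1, h2⟩ := hf.exists_third m x y
    exact ⟨k, hk, by have := h k hk; tauto⟩
  have k0 := key k hk hz
  have k2 := key (k + 2) (by omega) k0.1
  have k4 := key (k + 4) (by omega) k2.1
  refine hf k 4 (by norm_num) fun i hi ↦ ?_
  interval_cases i
  · exact hz.trans k2.1.symm
  · exact k0.2
  · exact k0.1.trans k4.1.symm
  · exact k2.2

/-- Whether a word (written backwards) ends in a letter `0` between two different other letters. -/
def EndsInBetween : List (Fin 3) → Bool
  | 2 :: 0 :: 1 :: _ => true
  | 1 :: 0 :: 2 :: _ => true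
  | _ => false

/-- Whether a word (written backwards) ends in a square of length at most `16`, or in a letter `0`
between two different other letters. -/
def EndsInPattern (w : List (Fin 3)) : Bool :=
  ((List.range 8).any fun t ↦
    2 * (t + 1) ≤ w.length && w.take (t + 1) == (w.drop (t + 1)).take (t + 1)) || EndsInBetween w

/-- Whether every extension of a word by `n` letters runs into a pattern. -/
def AllExtensionsEnd : ℕ → List (Fin 3) → Bool
  | 0, w => EndsInPattern w
  | n + 1, w => EndsInPattern w || (AllExtensionsEnd n (0 :: w) && AllExtensionsEnd n (1 :: w) &&
      AllExtensionsEnd n (2 :: w))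

theorem allExtensionsEnd_nil : AllExtensionsEnd 16 [] = true := by
  decide +kernel

/-- The first `n` letters of a sequence, backwards. -/
def prefixRev (g : ℕ → α) (n : ℕ) : List α := (List.range n).reverse.map g

theorem prefixRev_succ (g : ℕ → α) (n : ℕ) : prefixRev g (n + 1) = g n :: prefixRev g n := by
  simp [prefixRev, List.range_succ]

theorem exists_endsInPattern (g : ℕ → Fin 3) :
    ∀ n j, AllExtensionsEnd n (prefixRev g j) = true → ∃ i, EndsInPattern (prefixRev g i) = true
  | 0, j, h => ⟨j, h⟩
  | n + 1, j, h => by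
    rw [AllExtensionsEnd, Bool.or_eq_true, Bool.and_eq_true, Bool.and_eq_true] at h
    rcases h with h | ⟨⟨h0, h1⟩, h2⟩
    · exact ⟨j, h⟩
    · refine exists_endsInPattern g n (j + 1) ?_
      rw [prefixRev_succ]
      generalize g j = x at *
      fin_cases x
      · exact h0
      · exact h1
      · exact h2

/-- A finite search: every ternary word of length 16 contains a square or a `0` flanked by `1` and
`2` in some order. -/
theorem SquareFreeSeq.exists_between_fin {g : ℕ → Fin 3} (hg : SquareFreeSeq g) :
    ∃ k, g (k + 1) = 0 ∧ ((g k = 1 ∧ g (k + 2) = 2) ∨ (g k = 2 ∧ g (k + 2) = 1)) := by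
  obtain ⟨i, hi⟩ := exists_endsInPattern g 16 0 allExtensionsEnd_nil
  rw [EndsInPattern, Bool.or_eq_true] at hi
  rcases hi with hi | hi
  · exfalso
    rw [List.any_eq_true] at hi
    obtain ⟨t, -, ht⟩ := hi
    rw [Bool.and_eq_true, decide_eq_true_eq, beq_iff_eq] at ht
    obtain ⟨hl, he⟩ := ht
    have hlen : (prefixRev g i).length = i := by simp [prefixRev]
    rw [hlen] at hl
    refine hg (i - 2 * (t + 1)) (t + 1) (Nat.succ_pos _) fun j hj ↦ ?_
    have h1 : ((prefixRev g i).take (t + 1))[t - j]? =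
        (((prefixRev g i).drop (t + 1)).take (t + 1))[t - j]? := by rw [he]
    rw [List.getElem?_take_of_lt (by omega), List.getElem?_take_of_lt (by omega),
      List.getElem?_drop] at h1
    have hget : ∀ n, n < i → (prefixRev g i)[n]? = some (g (i - 1 - n)) := by
      intro n hn
      simp [prefixRev, hn]
    rw [hget _ (by omega), hget _ (by omega)] at h1
    have h2 := Option.some.inj h1
    have e1 : i - 1 - (t - j) = i - 2 * (t + 1) + (t + 1) + j := by omega
    have e2 : i - 1 - (t + 1 + (t - j)) = i - 2 * (t + 1) + j := by omega
    rw [e1, e2] at h2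
    exact h2.symm
  · match i, hi with
    | 0, hi => simp [prefixRev, EndsInBetween] at hi
    | 1, hi => simp [prefixRev, EndsInBetween] at hi
    | 2, hi => simp [prefixRev, EndsInBetween, List.range_succ] at hi
    | k + 3, hi =>
      refine ⟨k, ?_⟩
      rw [prefixRev_succ, prefixRev_succ, prefixRev_succ] at hi
      generalize g k = x at *
      generalize g (k + 1) = y at *
      generalize g (k + 2) = z at *
      revert hi
      fin_cases x <;> fin_cases y <;> fin_cases z <;> simp [EndsInBetween]

theorem SquareFreeSeq.exists_between {f : ℕ → α} (hf : SquareFreeSeq f) (m : ℕ) {a d e : α}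
    (h : ∀ k ≥ m, f k = a ∨ f k = d ∨ f k = e) :
    ∃ k ≥ m, f (k + 1) = a ∧ ((f k = d ∧ f (k + 2) = e) ∨ (f k = e ∧ f (k + 2) = d)) := by
  have : ∀ k, ∃ x : Fin 3, ![a, d, e] x = f (m + k) := by
    intro k
    rcases h (m + k) (by omega) with h | h | h
    · exact ⟨0, h.symm⟩
    · exact ⟨1, h.symm⟩
    · exact ⟨2, h.symm⟩
  choose g hg using this
  have hgs : SquareFreeSeq g := by
    intro i t ht hi
    refine hf.shift m i t ht fun j hj ↦ ?_
    simp only [← hg, hi j hj]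
  obtain ⟨k, h0, h1⟩ := hgs.exists_between_fin
  refine ⟨m + k, by omega, ?_, ?_⟩
  · rw [add_assoc, ← hg, h0]
    rfl
  · rcases h1 with ⟨h1, h2⟩ | ⟨h1, h2⟩
    · left
      rw [add_assoc, ← hg, ← hg, h1, h2]
      exact ⟨rfl, rfl⟩
    · right
      rw [add_assoc, ← hg, ← hg, h1, h2]
      exact ⟨rfl, rfl⟩

end Words

/-! ### The sibling tree and its one-page embedding -/

/-- The infinite tree in which every vertex has children indexed by `ℕ`, with additional edges
between consecutive children. -/
def siblingTree : SimpleGraph (List ℕ) :=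
  SimpleGraph.fromRel fun u v ↦ (∃ k, v = u ++ [k]) ∨ ∃ p k, u = p ++ [k] ∧ v = p ++ [k + 1]

theorem siblingTree_adj_child (u : List ℕ) (k : ℕ) : siblingTree.Adj u (u ++ [k]) := by
  simp [siblingTree]

theorem siblingTree_adj_sibling (p : List ℕ) (k : ℕ) :
    siblingTree.Adj (p ++ [k]) (p ++ [k + 1]) := by
  simp [siblingTree]

theorem lex_between {l k : List ℕ} {t : ℕ} (h1 : l < k) (h2 : k < l ++ [t]) :
    ∃ s r, k = l ++ s :: r ∧ s < t := by
  induction l generalizing k with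
  | nil =>
    cases k with
    | nil => simp at h1
    | cons s r =>
      refine ⟨s, r, rfl, ?_⟩
      simpa [List.cons_lt_cons_iff] using h2
  | cons a l ih =>
    cases k with
    | nil => simp at h1
    | cons b k =>
      rw [List.cons_append] at h2
      rw [List.cons_lt_cons_iff] at h1 h2
      have hab : a = b := by omega
      subst hab
      obtain ⟨s, r, rfl, hs⟩ := ih (by simpa using h1) (by simpa using h2)
      exact ⟨s, r, rfl, hs⟩

theorem append_lt_append_cons (l : List ℕ) {s t : ℕ} (h : s < t) (r r' : List ℕ) :
    l ++ s :: r < l ++ t :: r' := by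
  induction l with
  | nil => simpa [List.cons_lt_cons_iff] using Or.inl h
  | cons a l ih => simpa [List.cons_lt_cons_iff] using ih

theorem lt_append_cons (l : List ℕ) (s : ℕ) (r : List ℕ) : l < l ++ s :: r := by
  induction l with
  | nil => simp
  | cons a l ih => simpa [List.cons_lt_cons_iff] using ih

theorem siblingTree_adj_of_lt {u v : List ℕ} (h : siblingTree.Adj u v) (hlt : u < v) :
    (∃ k, v = u ++ [k]) ∨ ∃ p k, u = p ++ [k] ∧ v = p ++ [k + 1] := by
  rw [siblingTree, SimpleGraph.fromRel_adj] at h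
  rcases h.2 with h | ⟨k, rfl⟩ | ⟨p, k, rfl, rfl⟩
  · exact h
  · exact absurd hlt (lt_append_cons _ _ _).not_gt
  · exact absurd hlt (append_lt_append_cons _ (Nat.lt_succ_self k) _ _).not_gt

/-- Preorder is a one-page book embedding of `siblingTree`. -/
theorem siblingTree_not_crossing {i k j m : List ℕ} (hik : i < k) (hkj : k < j) (hjm : j < m)
    (hij : siblingTree.Adj i j) (hkm : siblingTree.Adj k m) : False := by
  -- Here `l` is the parent of `j`. Since `k` lies between `l` and `j`, it is an earlier sibling of
  -- `j` or a descendant of one, and no later neighbour of such a vertex lies beyond `j`.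
  obtain ⟨l, t, rfl, hl⟩ : ∃ l t, j = l ++ [t] ∧ l ≤ i := by
    rcases siblingTree_adj_of_lt hij (hik.trans hkj) with ⟨t, rfl⟩ | ⟨l, t, rfl, rfl⟩
    · exact ⟨i, t, rfl, le_rfl⟩
    · exact ⟨l, t + 1, rfl, (lt_append_cons _ _ _).le⟩
  obtain ⟨s, r, rfl, hst⟩ := lex_between (hl.trans_lt hik) hkj
  rcases siblingTree_adj_of_lt hkm (hkj.trans hjm) with ⟨u, rfl⟩ | ⟨p, u, hp, rfl⟩
  · rw [List.append_assoc, List.cons_append] at hjm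
    exact lt_asymm hjm (append_lt_append_cons _ hst _ _)
  · rcases List.eq_nil_or_concat r with rfl | ⟨r', a, rfl⟩
    · obtain ⟨rfl, h2⟩ := List.append_inj' hp rfl
      obtain rfl : s = u := by simpa using h2
      rcases (Nat.succ_le_of_lt hst).lt_or_eq with h | rfl
      · exact lt_asymm hjm (append_lt_append_cons _ h _ _)
      · exact lt_irrefl _ hjm
    · rw [List.concat_eq_append] at hp
      rw [← List.cons_append, ← List.append_assoc] at hp
      obtain ⟨rfl, -⟩ := List.append_inj' hp rfl
      rw [List.append_assoc, List.cons_append] at hjm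
      exact lt_asymm hjm (append_lt_append_cons _ hst _ _)

/-- `v` is a child of `u`. -/
def IsChild (u v : List ℕ) : Prop := ∃ k, v = u ++ [k]

/-! ### Six colours do not suffice for the sibling tree -/

section Colouring

variable {α : Type*} {c : List ℕ → α}

theorem IsNonrepetitive.false_of_descending (hc : IsNonrepetitive siblingTree c)
    {A B : List (List ℕ)} (hA : A ≠ []) (hAB : A.map c = B.map c) (h : (A ++ B).IsChain IsChild) :
    False := by
  refine hc.false_of_lists hA hAB (h.imp ?_) ?_
  · rintro u _ ⟨k, rfl⟩
    exact siblingTree_adj_child u k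
  · have h1 : (A ++ B).IsChain (fun u v ↦ u.length < v.length) := h.imp <| by
      rintro u _ ⟨k, rfl⟩
      simp
    have : IsTrans (List ℕ) (fun u v ↦ u.length < v.length) := ⟨fun _ _ _ ↦ lt_trans⟩
    exact h1.pairwise.imp fun {a b} hab heq ↦ by simp [heq] at hab

end Colouring

section Colouring

variable {α : Type*} {c : List ℕ → α}

/-- The colour `x` occurs on infinitely many children of `v`. -/
def Recurs (c : List ℕ → α) (v : List ℕ) (x : α) : Prop := ∃ᶠ k in atTop, c (v ++ [k]) = x

theorem Recurs.exists_child {v : List ℕ} {x : α} (h : Recurs c v x) :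
    ∃ w, IsChild v w ∧ c w = x := by
  obtain ⟨k, hk⟩ := h.exists
  exact ⟨_, ⟨k, rfl⟩, hk⟩

theorem Recurs.exists_index_ne {v : List ℕ} {x : α} (h : Recurs c v x) (j : ℕ) :
    ∃ k ≠ j, c (v ++ [k]) = x := by
  obtain ⟨k, hk, hx⟩ := (frequently_atTop.1 h) (j + 1)
  exact ⟨k, by omega, hx⟩

/-- Each of the finitely many colours that do not recur eventually disappears. -/
theorem eventually_recurs [Finite α] (c : List ℕ → α) (v : List ℕ) :
    ∀ᶠ k in atTop, Recurs c v (c (v ++ [k])) := by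
  have : ∀ᶠ k in atTop, ∀ x, ¬ Recurs c v x → c (v ++ [k]) ≠ x := by
    rw [eventually_all]
    intro x
    by_cases hx : Recurs c v x
    · exact Eventually.of_forall fun k h ↦ absurd hx h
    · exact (not_frequently.1 hx).mono fun k hk _ ↦ hk
  filter_upwards [this] with k hk
  by_contra h
  exact hk _ h rfl

section Squares

variable (hc : IsNonrepetitive siblingTree c)
include hc

theorem squareFreeSeq_children (v : List ℕ) : SquareFreeSeq fun k ↦ c (v ++ [k]) := by
  intro m t ht h
  let g : ℕ → List ℕ := fun k ↦ v ++ [m + k]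
  have hg : Function.Injective g := by
    intro i j hij
    simpa [g] using hij
  have hAB : (List.range t).map g ++ ((List.range t).map (t + ·)).map g =
      (List.range (t + t)).map g := by
    rw [← List.map_append, List.range_add]
  refine hc.false_of_lists (A := (List.range t).map g)
    (B := ((List.range t).map (t + ·)).map g) (by simp; omega) ?_ ?_ ?_
  · rw [List.map_map, List.map_map, List.map_map]
    refine List.map_congr_left fun i hi ↦ ?_
    have := h i (List.mem_range.1 hi)
    simpa [g, add_assoc] using this
  · rw [hAB, List.isChain_map]
    refine List.isChain_iff_getElem.2 fun i hi ↦ ?_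
    simp only [List.getElem_range]
    exact siblingTree_adj_sibling v (m + i)
  · rw [hAB]
    exact List.nodup_range.map hg

theorem Recurs.ne_self {v : List ℕ} {x : α} (h : Recurs c v x) : x ≠ c v := by
  rintro rfl
  obtain ⟨w, hw, hcw⟩ := h.exists_child
  exact hc.false_of_descending (A := [v]) (B := [w]) (by simp) (by simp [hcw]) (by simpa using hw)

/-- A vertex whose colour recurs among its siblings does not have the colour of its parent recurring
among its children. -/
theorem not_recurs_parent {p : List ℕ} {k : ℕ} (h : Recurs c p (c (p ++ [k]))) :
    ¬ Recurs c (p ++ [k]) (c p) := by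
  intro h'
  obtain ⟨j, hj⟩ := h'.exists
  obtain ⟨i, hik, hi⟩ := h.exists_index_ne k
  refine hc.false_of_lists (A := [p ++ [k] ++ [j], p ++ [k]]) (B := [p, p ++ [i]]) (by simp)
    (by simp [← hj, hi]) ?_ ?_
  · simp only [List.cons_append, List.nil_append, List.isChain_cons_cons, List.isChain_singleton,
      and_true]
    exact ⟨(siblingTree_adj_child _ _).symm, (siblingTree_adj_child _ _).symm,
      siblingTree_adj_child _ _⟩
  · simp [hik.symm]

/-- Otherwise child, sibling, sibling, child is a path whose colours repeat with period two. -/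
theorem not_recurs_sibling {p : List ℕ} {i j : ℕ} (hij : j = i + 1 ∨ i = j + 1)
    (h : Recurs c (p ++ [i]) (c (p ++ [j]))) : ¬ Recurs c (p ++ [j]) (c (p ++ [i])) := by
  have hadj : siblingTree.Adj (p ++ [i]) (p ++ [j]) := by
    rcases hij with rfl | rfl
    · exact siblingTree_adj_sibling _ _
    · exact (siblingTree_adj_sibling _ _).symm
  have hne : i ≠ j := by omega
  intro h'
  obtain ⟨s, hs⟩ := h.exists
  obtain ⟨t, ht⟩ := h'.exists
  refine hc.false_of_lists (A := [p ++ [i] ++ [s], p ++ [i]]) (B := [p ++ [j], p ++ [j] ++ [t]])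
    (by simp) (by simp only [List.map_cons, List.map_nil, hs, ht]) ?_ ?_
  · simp only [List.cons_append, List.nil_append, List.isChain_cons_cons, List.isChain_singleton,
      and_true]
    exact ⟨(siblingTree_adj_child _ _).symm, hadj, siblingTree_adj_child _ _⟩
  · simp [hne]

/-- Otherwise climb from a grandchild of `i` through `l` to `i`, cross `j` to `k` and descend to a
child: the six colours are those of `j, k, i, j, k, i`. -/
theorem not_recurs_across {p : List ℕ} {i j k l : ℕ} (hij : j = i + 1 ∨ i = j + 1)
    (hjk : k = j + 1 ∨ j = k + 1) (hik : i ≠ k) (hl : c (p ++ [i] ++ [l]) = c (p ++ [k]))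
    (h : Recurs c (p ++ [k]) (c (p ++ [i]))) :
    ¬ Recurs c (p ++ [i] ++ [l]) (c (p ++ [j])) := by
  have hadj : ∀ i j, j = i + 1 ∨ i = j + 1 → siblingTree.Adj (p ++ [i]) (p ++ [j]) := by
    rintro i j (rfl | rfl)
    · exact siblingTree_adj_sibling _ _
    · exact (siblingTree_adj_sibling _ _).symm
  intro h'
  obtain ⟨s, hs⟩ := h.exists
  obtain ⟨t, ht⟩ := h'.exists
  refine hc.false_of_lists (A := [p ++ [i] ++ [l] ++ [t], p ++ [i] ++ [l], p ++ [i]])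
    (B := [p ++ [j], p ++ [k], p ++ [k] ++ [s]]) (by simp) ?_ ?_ ?_
  · simp only [List.map_cons, List.map_nil, hs, ht, hl]
  · simp only [List.cons_append, List.nil_append, List.isChain_cons_cons, List.isChain_singleton,
      and_true]
    exact ⟨(siblingTree_adj_child _ _).symm, (siblingTree_adj_child _ _).symm, hadj _ _ hij,
      hadj _ _ hjk, siblingTree_adj_child _ _⟩
  · have : i ≠ j := by omega
    have : j ≠ k := by omega
    simp [*]

end Squares

/-- `A`, …, `F` are six distinct colours, and there are no others. -/
structure Palette (A B C D E F : α) : Prop where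
  nodup : [A, B, C, D, E, F].Nodup
  exhaust : ∀ x, x = A ∨ x = B ∨ x = C ∨ x = D ∨ x = E ∨ x = F

theorem Palette.step {A B C D E F : α} (h : Palette A B C D E F) : Palette C D B A F E := by
  refine ⟨?_, fun x ↦ by have := h.exhaust x; tauto⟩
  have := h.nodup
  grind

theorem Palette.swap {A B C D E F : α} (h : Palette A B C D E F) : Palette A B C E D F := by
  refine ⟨?_, fun x ↦ by have := h.exhaust x; tauto⟩
  have := h.nodup
  grind

theorem Palette.rotate {A B C D E F : α} (h : Palette A B C D E F) : Palette B C A F E D := by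
  refine ⟨?_, fun x ↦ by have := h.exhaust x; tauto⟩
  have := h.nodup
  grind

/-- At least three colours recur below every vertex, so excluding three of the six leaves no choice.
-/
theorem recurs_of_not [Finite α] (hc : IsNonrepetitive siblingTree c) {A B C D E F : α}
    (h : ∀ x, x = A ∨ x = B ∨ x = C ∨ x = D ∨ x = E ∨ x = F) {v : List ℕ} (hA : ¬ Recurs c v A) (hB : ¬ Recurs c v B)
    (hC : ¬ Recurs c v C) : Recurs c v D ∧ Recurs c v E ∧ Recurs c v F := by
  have key : ∀ x y, ∃ z, z ≠ x ∧ z ≠ y ∧ Recurs c v z := by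
    intro x y
    obtain ⟨m, hm⟩ := eventually_atTop.1 (eventually_recurs c v)
    obtain ⟨k, hk, hx, hy⟩ := (squareFreeSeq_children hc v).exists_third m x y
    exact ⟨_, hx, hy, hm k hk⟩
  refine ⟨?_, ?_, ?_⟩
  · obtain ⟨z, hx, hy, hz⟩ := key E F
    rcases h z with rfl | rfl | rfl | rfl | rfl | rfl <;> first | assumption | contradiction
  · obtain ⟨z, hx, hy, hz⟩ := key D F
    rcases h z with rfl | rfl | rfl | rfl | rfl | rfl <;> first | assumption | contradiction
  · obtain ⟨z, hx, hy, hz⟩ := key D E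
    rcases h z with rfl | rfl | rfl | rfl | rfl | rfl <;> first | assumption | contradiction

/-- From some point on, below every child of `q` of colour `x` all other colours recur that recur
below `q`. -/
def AllFull (c : List ℕ → α) (q : List ℕ) (x : α) : Prop :=
  ∀ᶠ k in atTop, c (q ++ [k]) = x → ∀ y, Recurs c q y → y ≠ x → Recurs c (q ++ [k]) y

theorem exists_of_not_allFull {q : List ℕ} {x : α} (h : ¬ AllFull c q x) :
    ∃ k, c (q ++ [k]) = x ∧ ∃ y, Recurs c q y ∧ y ≠ x ∧ ¬ Recurs c (q ++ [k]) y := by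
  obtain ⟨k, hk⟩ := (not_eventually.1 h).exists
  push Not at hk
  exact ⟨k, hk⟩

/-- A parent `p` and its child `q` such that exactly the colours `A`, `D`, `E` recur below `q`, where
`A` is full. -/
structure Obstruction (c : List ℕ → α) (p q : List ℕ) (A B C D E F : α) : Prop where
  palette : Palette A B C D E F
  child : IsChild p q
  colour_parent : c p = B
  colour : c q = C
  recurs : Recurs c p C
  recurs_iff : ∀ x, Recurs c q x ↔ x = A ∨ x = D ∨ x = E
  allFull : AllFull c q A

/-- The new pair is a `D`-child `w` of `q` and a `B`-child `v` of `w`. The fullness of `A` is what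
restricts the neighbours of an `A`-child. -/
theorem Obstruction.step [Finite α] (hc : IsNonrepetitive siblingTree c) {p q : List ℕ}
    {A B C D E F : α} (h : Obstruction c p q A B C D E F) :
    ∃ w v, IsChild q w ∧ c w = D ∧ Obstruction c w v C D B A F E := by
  obtain ⟨hpal, hchild, hcp, hcq, hpC, hrec, hfull⟩ := h
  obtain ⟨hnd, hall⟩ := id hpal
  have hrq : ∀ x, x = A ∨ x = D ∨ x = E → Recurs c q x := fun x ↦ (hrec x).2
  obtain ⟨m, hm⟩ := eventually_atTop.1 ((eventually_recurs c q).and hfull)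
  -- Late children of `q` use only `A`, `D`, `E`, so somewhere an `A`-child separates a `D`-child
  -- from an `E`-child. Fullness makes `D` and `E` recur below it, hence `A` recurs below neither
  -- neighbour.
  obtain ⟨i, j, k, hij, hjk, hik, hjm, hi, hj, hk⟩ : ∃ i j k : ℕ, (j = i + 1 ∨ i = j + 1) ∧
      (k = j + 1 ∨ j = k + 1) ∧ i ≠ k ∧ m ≤ j ∧ c (q ++ [i]) = D ∧ c (q ++ [j]) = A ∧
      c (q ++ [k]) = E := by
    obtain ⟨n, hn, h1, h2 | h2⟩ := (squareFreeSeq_children hc q).exists_between m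
      (fun k hk ↦ (hrec _).1 (hm k hk).1)
    · exact ⟨n, n + 1, n + 2, by omega, by omega, by omega, by omega, h2.1, h1, h2.2⟩
    · exact ⟨n + 2, n + 1, n, by omega, by omega, by omega, by omega, h2.2, h1, h2.1⟩
  have hAD : D ≠ A := by rintro rfl; simp at hnd
  have hAE : E ≠ A := by rintro rfl; simp at hnd
  have hjfull := (hm j hjm).2 hj
  -- the child of colour `D`
  have hwA : ¬ Recurs c (q ++ [i]) A := by
    have := not_recurs_sibling hc (p := q) (i := j) (j := i) (by omega)
    rw [hi, hj] at this
    exact this (hjfull D (hrq D (by simp)) hAD)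
  have hwC : ¬ Recurs c (q ++ [i]) C := by
    rw [← hcq]
    exact not_recurs_parent hc (by rw [hi]; exact hrq D (by simp))
  have hwD : ¬ Recurs c (q ++ [i]) D := fun h ↦ h.ne_self hc hi.symm
  obtain ⟨hwB, hwE, hwF⟩ :=
    recurs_of_not hc (A := A) (B := C) (C := D) (D := B) (E := E) (F := F)
        (fun x ↦ by simpa only [or_comm, or_left_comm] using hall x)
      hwA hwC hwD
  have hwrec : ∀ x, Recurs c (q ++ [i]) x → x = B ∨ x = E ∨ x = F := by
    intro x hx
    rcases hall x with rfl | rfl | rfl | rfl | rfl | rfl <;> first | contradiction | simp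
  -- the child of colour `E`
  have heA : ¬ Recurs c (q ++ [k]) A := by
    have := not_recurs_sibling hc (p := q) (i := j) (j := k) (by omega)
    rw [hk, hj] at this
    exact this (hjfull E (hrq E (by simp)) hAE)
  have heC : ¬ Recurs c (q ++ [k]) C := by
    rw [← hcq]
    exact not_recurs_parent hc (by rw [hk]; exact hrq E (by simp))
  have heE : ¬ Recurs c (q ++ [k]) E := fun h ↦ h.ne_self hc hk.symm
  obtain ⟨-, heD, -⟩ :=
    recurs_of_not hc (A := A) (B := C) (C := E) (D := B) (E := D) (F := F)
        (fun x ↦ by simpa only [or_comm, or_left_comm] using hall x)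
      heA heC heE
  -- An `E`-child of `w` excludes its own colour, its parent's colour `D`, and `A` by the six-vertex
  -- path through `i, j, k`; so `B` recurs below it.
  have hEfull : ∀ l, c (q ++ [i] ++ [l]) = E → Recurs c (q ++ [i] ++ [l]) B := by
    intro l hl
    have h1 : ¬ Recurs c (q ++ [i] ++ [l]) D := by
      rw [← hi]
      exact not_recurs_parent hc (by rw [hl]; exact hwE)
    have h2 : ¬ Recurs c (q ++ [i] ++ [l]) E := fun h ↦ h.ne_self hc hl.symm
    have h3 : ¬ Recurs c (q ++ [i] ++ [l]) A := by
      have := not_recurs_across hc hij hjk hik (hl.trans hk.symm) (by rw [hi]; exact heD)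
      rwa [hj] at this
    exact (recurs_of_not hc (A := A) (B := D) (C := E) (D := B) (E := C) (F := F)
        (fun x ↦ by simpa only [or_comm, or_left_comm] using hall x) h3 h1 h2).1
  obtain ⟨m', hm'⟩ := eventually_atTop.1 (eventually_recurs c (q ++ [i]))
  -- A `B`-child of `w` next to an `E`-child: as `B` recurs below the latter, `E` cannot recur below
  -- the former.
  obtain ⟨s, t, hst, hs, ht⟩ : ∃ s t : ℕ, (t = s + 1 ∨ s = t + 1) ∧
      c (q ++ [i] ++ [s]) = B ∧ c (q ++ [i] ++ [t]) = E := by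
    obtain ⟨n, hn, h2 | h2⟩ := (squareFreeSeq_children hc (q ++ [i])).exists_adjacent m'
      (fun k hk ↦ hwrec _ (hm' k hk))
    · exact ⟨n, n + 1, by omega, h2⟩
    · exact ⟨n + 1, n, by omega, h2.symm⟩
  have hvE : ¬ Recurs c (q ++ [i] ++ [s]) E := by
    have := not_recurs_sibling hc (p := q ++ [i]) (i := t) (j := s) (by omega)
    rw [hs, ht] at this
    exact this (hEfull t ht)
  have hvD : ¬ Recurs c (q ++ [i] ++ [s]) D := by
    rw [← hi]
    exact not_recurs_parent hc (by rw [hs]; exact hwB)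
  have hvB : ¬ Recurs c (q ++ [i] ++ [s]) B := fun h ↦ h.ne_self hc hs.symm
  obtain ⟨hvA, hvC, hvF⟩ :=
    recurs_of_not hc (A := B) (B := D) (C := E) (D := A) (E := C) (F := F)
        (fun x ↦ by simpa only [or_comm, or_left_comm] using hall x)
      hvB hvD hvE
  have hvrec : ∀ x, Recurs c (q ++ [i] ++ [s]) x ↔ x = C ∨ x = A ∨ x = F := by
    intro x
    constructor
    · intro hx
      rcases hall x with rfl | rfl | rfl | rfl | rfl | rfl <;> first | contradiction | simp
    · rintro (rfl | rfl | rfl) <;> assumption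
  refine ⟨q ++ [i], q ++ [i] ++ [s], ⟨i, rfl⟩, hi, hpal.step, ⟨s, rfl⟩, hi, hs, hwB, hvrec, ?_⟩
  -- If `C` is not full below `v`, then `D` recurs below some `C`-child of `v`, and the descending
  -- path from `p` reads `B C D B C D`.
  by_contra hnf
  obtain ⟨n, hn, y, hy, hyC, hny⟩ := exists_of_not_allFull hnf
  have huC : ¬ Recurs c (q ++ [i] ++ [s] ++ [n]) C := fun h ↦ h.ne_self hc hn.symm
  have huB : ¬ Recurs c (q ++ [i] ++ [s] ++ [n]) B := by
    rw [← hs]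
    exact not_recurs_parent hc (by rw [hn]; exact hvC)
  have huD : Recurs c (q ++ [i] ++ [s] ++ [n]) D := by
    rcases (hvrec y).1 hy with rfl | rfl | rfl
    · exact absurd rfl hyC
    · exact (recurs_of_not hc (A := B) (B := C) (C := y) (D := D) (E := E) (F := F)
        (fun x ↦ by simpa only [or_comm, or_left_comm] using hall x) huB huC hny).1
    · exact (recurs_of_not hc (A := B) (B := C) (C := y) (D := D) (E := E) (F := A)
        (fun x ↦ by simpa only [or_comm, or_left_comm] using hall x) huB huC hny).1
  obtain ⟨z, hz, hzD⟩ := huD.exists_child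
  refine hc.false_of_descending (A := [p, q, q ++ [i]])
    (B := [q ++ [i] ++ [s], q ++ [i] ++ [s] ++ [n], z]) (by simp)
    (by simp only [List.map_cons, List.map_nil, hcp, hcq, hi, hs, hn, hzD]) ?_
  simp only [List.cons_append, List.nil_append, List.isChain_cons_cons, List.isChain_singleton,
      and_true]
  exact ⟨hchild, ⟨i, rfl⟩, ⟨s, rfl⟩, ⟨n, rfl⟩, hz⟩

/-- The permutation in `step` has order four, so the descent emits `DB AD CA BC` twice. -/
theorem Obstruction.false [Finite α] (hc : IsNonrepetitive siblingTree c) {p q : List ℕ}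
    {A B C D E F : α} (h : Obstruction c p q A B C D E F) : False := by
  obtain ⟨w1, v1, a1, b1, h1⟩ := h.step hc
  obtain ⟨w2, v2, a2, b2, h2⟩ := h1.step hc
  obtain ⟨w3, v3, a3, b3, h3⟩ := h2.step hc
  obtain ⟨w4, v4, a4, b4, h4⟩ := h3.step hc
  obtain ⟨w5, v5, a5, b5, h5⟩ := h4.step hc
  obtain ⟨w6, v6, a6, b6, h6⟩ := h5.step hc
  obtain ⟨w7, v7, a7, b7, h7⟩ := h6.step hc
  obtain ⟨w8, v8, a8, b8, h8⟩ := h7.step hc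
  refine hc.false_of_descending (A := [w1, v1, w2, v2, w3, v3, w4, v4])
    (B := [w5, v5, w6, v6, w7, v7, w8, v8]) (by simp) ?_ ?_
  · simp only [List.map_cons, List.map_nil, b1, b2, b3, b4, b5, b6, b7, b8, h1.colour, h2.colour,
      h3.colour, h4.colour, h5.colour, h6.colour, h7.colour, h8.colour]
  · simp only [List.cons_append, List.nil_append, List.isChain_cons_cons, List.isChain_singleton,
      and_true]
    exact ⟨h1.child, a2, h2.child, a3, h3.child, a4, h4.child, a5, h5.child, a6, h6.child, a7,
      h7.child, a8, h8.child⟩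

end Colouring

theorem exists_palette {A B C F : Fin 6} (h : [A, B, C, F].Nodup) : ∃ D E, Palette A B C D E F := by
  have h1 : (Finset.univ \ ({A, B, C, F} : Finset (Fin 6))).card = 2 := by
    rw [Finset.card_sdiff_of_subset (Finset.subset_univ _)]
    have : ({A, B, C, F} : Finset (Fin 6)) = [A, B, C, F].toFinset := by
      ext
      simp
    rw [this, List.toFinset_card_of_nodup h]
    rfl
  obtain ⟨D, E, hDE, hs⟩ := Finset.card_eq_two.1 h1
  have hmem : ∀ x, (x ≠ A ∧ x ≠ B ∧ x ≠ C ∧ x ≠ F) ↔ (x = D ∨ x = E) := by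
    intro x
    have := Finset.ext_iff.1 hs x
    simpa using this
  have hD := (hmem D).2 (Or.inl rfl)
  have hE := (hmem E).2 (Or.inr rfl)
  refine ⟨D, E, ?_, fun x ↦ ?_⟩
  · grind
  · have := hmem x
    tauto

/-- The tree with adjacent siblings has no nonrepetitive colouring with six colours. -/
theorem not_isNonrepetitive_siblingTree (c : List ℕ → Fin 6) : ¬ IsNonrepetitive siblingTree c := by
  intro hc
  have hsq := squareFreeSeq_children hc
  obtain ⟨k, hk⟩ := (eventually_recurs c []).exists
  generalize hp : ([] : List ℕ) ++ [k] = p at hk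
  have hpA : ¬ Recurs c p (c []) := by
    have := not_recurs_parent hc (p := []) (k := k) (by rwa [hp])
    rwa [hp] at this
  obtain ⟨m, hm⟩ := eventually_atTop.1 (eventually_recurs c p)
  -- Recurrence is not mutual between adjacent siblings, so one of the two lacks the other's colour
  -- `F`. Together with `B` and `C` this fixes what recurs below it.
  obtain ⟨i, j, hi, hj, hne, hij⟩ : ∃ i j, Recurs c p (c (p ++ [i])) ∧ Recurs c p (c (p ++ [j])) ∧
      c (p ++ [i]) ≠ c (p ++ [j]) ∧ ¬ Recurs c (p ++ [i]) (c (p ++ [j])) := by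
    by_cases h : Recurs c (p ++ [m]) (c (p ++ [m + 1]))
    · exact ⟨m + 1, m, hm _ (by omega), hm _ le_rfl, ((hsq p).succ_ne m).symm,
        not_recurs_sibling hc (by omega) h⟩
    · exact ⟨m, m + 1, hm _ le_rfl, hm _ (by omega), (hsq p).succ_ne m, h⟩
  generalize hA : c [] = A at *
  generalize hB : c p = B at *
  generalize hC : c (p ++ [i]) = C at *
  generalize c (p ++ [j]) = F at *
  have hBA : B ≠ A := by
    rw [← hA]
    exact hk.ne_self hc
  have hCB : C ≠ B := by
    rw [← hB]
    exact hi.ne_self hc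
  have hFB : F ≠ B := by
    rw [← hB]
    exact hj.ne_self hc
  have hCA : C ≠ A := fun h ↦ hpA (h ▸ hi)
  have hFA : F ≠ A := fun h ↦ hpA (h ▸ hj)
  obtain ⟨D, E, hpal⟩ := exists_palette (A := A) (B := B) (C := C) (F := F) (by grind)
  obtain ⟨hnd, hall⟩ := id hpal
  have hqB : ¬ Recurs c (p ++ [i]) B := by
    rw [← hB]
    exact not_recurs_parent hc (by rwa [hC])
  have hqC : ¬ Recurs c (p ++ [i]) C := fun h ↦ h.ne_self hc hC.symm
  obtain ⟨hqA, hqD, hqE⟩ :=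
    recurs_of_not hc (A := B) (B := C) (C := F) (D := A) (E := D) (F := E)
        (fun x ↦ by simpa only [or_comm, or_left_comm] using hall x)
      hqB hqC hij
  have hqrec : ∀ x, Recurs c (p ++ [i]) x ↔ x = A ∨ x = D ∨ x = E := by
    intro x
    constructor
    · intro hx
      rcases hall x with rfl | rfl | rfl | rfl | rfl | rfl <;> first | contradiction | simp
    · rintro (rfl | rfl | rfl) <;> assumption
  by_cases hfull : AllFull c (p ++ [i]) A
  · exact Obstruction.false hc (p := p) (q := p ++ [i]) (A := A) (B := B) (C := C) (D := D) (E := E)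
      (F := F) ⟨⟨hnd, hall⟩, ⟨i, rfl⟩, hB, hC, hi, hqrec, hfull⟩
  -- If `A` is not full, a deficient `A`-child takes over the role of `q`, with `B` as the candidate
  -- full colour.
  obtain ⟨n, hn, y, hy, hyA, hny⟩ := exists_of_not_allFull hfull
  have hwA : ¬ Recurs c (p ++ [i] ++ [n]) A := fun h ↦ h.ne_self hc hn.symm
  have hwC : ¬ Recurs c (p ++ [i] ++ [n]) C := by
    rw [← hC]
    exact not_recurs_parent hc (by rwa [hn])
  obtain ⟨y', hyy'⟩ : ∃ y', (y = D ∧ y' = E) ∨ (y = E ∧ y' = D) := by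
    rcases (hqrec y).1 hy with rfl | rfl | rfl
    · exact absurd rfl hyA
    · exact ⟨E, Or.inl ⟨rfl, rfl⟩⟩
    · exact ⟨D, Or.inr ⟨rfl, rfl⟩⟩
  have hpal' : Palette B C A F y' y := by
    rcases hyy' with ⟨rfl, rfl⟩ | ⟨rfl, rfl⟩
    · exact hpal.rotate
    · exact hpal.swap.rotate
  have hall' := hpal'.exhaust
  obtain ⟨hwB, hwF, hwy'⟩ :=
    recurs_of_not hc (A := A) (B := C) (C := y) (D := B) (E := F) (F := y')
        (fun x ↦ by simpa only [or_comm, or_left_comm] using hall' x)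
      hwA hwC hny
  have hwrec : ∀ x, Recurs c (p ++ [i] ++ [n]) x ↔ x = B ∨ x = F ∨ x = y' := by
    intro x
    constructor
    · intro hx
      rcases hall' x with rfl | rfl | rfl | rfl | rfl | rfl <;> first | contradiction | simp
    · rintro (rfl | rfl | rfl) <;> assumption
  by_cases hfull' : AllFull c (p ++ [i] ++ [n]) B
  · exact Obstruction.false hc (p := p ++ [i]) (q := p ++ [i] ++ [n])
      ⟨hpal', ⟨n, rfl⟩, hC, hn, hqA, hwrec, hfull'⟩
  -- If `B` is not full either, `C` recurs below a `B`-child and the descent from the root reads `A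
  -- B C A B C`.
  obtain ⟨r, hr, z, hz, hzB, hnz⟩ := exists_of_not_allFull hfull'
  have hvB : ¬ Recurs c (p ++ [i] ++ [n] ++ [r]) B := fun h ↦ h.ne_self hc hr.symm
  have hvA : ¬ Recurs c (p ++ [i] ++ [n] ++ [r]) A := by
    rw [← hn]
    exact not_recurs_parent hc (by rwa [hr])
  have hvC : Recurs c (p ++ [i] ++ [n] ++ [r]) C := by
    rcases (hwrec z).1 hz with rfl | rfl | rfl
    · exact absurd rfl hzB
    · exact (recurs_of_not hc (A := A) (B := B) (C := z) (D := C) (E := y) (F := y')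
        (fun x ↦ by simpa only [or_comm, or_left_comm] using hall' x) hvA hvB hnz).1
    · exact (recurs_of_not hc (A := A) (B := B) (C := z) (D := C) (E := y) (F := F)
        (fun x ↦ by simpa only [or_comm, or_left_comm] using hall' x) hvA hvB hnz).1
  obtain ⟨t, ht, htC⟩ := hvC.exists_child
  refine hc.false_of_descending (A := [[], p, p ++ [i]])
    (B := [p ++ [i] ++ [n], p ++ [i] ++ [n] ++ [r], t]) (by simp)
    (by simp only [List.map_cons, List.map_nil, hA, hB, hC, hn, hr, htC]) ?_
  simp only [List.cons_append, List.nil_append, List.isChain_cons_cons, List.isChain_singleton,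
      and_true]
  exact ⟨⟨k, hp.symm⟩, ⟨i, rfl⟩, ⟨n, rfl⟩, ⟨r, rfl⟩, ht⟩

/-! ### Plane drawings from book embeddings -/

section Drawing

variable {V : Type*} {G : SimpleGraph V}

/-- The arc of the parabola `y = σ (x - a) (b - x)` between its two zeros. -/
noncomputable def parabolaArc (a b σ : ℝ) : C(unitInterval, Plane) where
  toFun t := !₂[a + t * (b - a), σ * ((t * (b - a)) * ((1 - t) * (b - a)))]
  continuous_toFun := by
    refine (PiLp.continuous_toLp 2 _).comp (continuous_pi fun i ↦ ?_)
    fin_cases i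
    · simp only [Fin.zero_eta, Matrix.cons_val_zero]
      fun_prop
    · simp only [Fin.mk_one, Matrix.cons_val_one, Matrix.cons_val_fin_one]
      fun_prop

theorem parabolaArc_apply_zero (a b σ : ℝ) (t : unitInterval) :
    parabolaArc a b σ t 0 = a + t * (b - a) := rfl

theorem parabolaArc_apply_one (a b σ : ℝ) (t : unitInterval) :
    parabolaArc a b σ t 1 = σ * ((t * (b - a)) * ((1 - t) * (b - a))) := rfl

theorem plane_ext {p q : Plane} (h0 : p 0 = q 0) (h1 : p 1 = q 1) : p = q := by
  ext i
  fin_cases i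
  · exact h0
  · exact h1

/-- The sign of a page of a two-page book embedding. -/
def pageSign (b : Bool) : ℝ := if b then 1 else -1

theorem pageSign_ne_zero (b : Bool) : pageSign b ≠ 0 := by
  cases b <;> simp [pageSign]

/-- A two-page book embedding yields a drawing in the plane with all vertices on a line and one page
on each side of it. -/
theorem exists_planeDrawing (pos : V → ℝ) (hpos : Function.Injective pos) (page : Sym2 V → Bool)
    (hcross : ∀ i k j m, pos i < pos k → pos k < pos j → pos j < pos m → G.Adj i j → G.Adj k m →
      page s(i, j) ≠ page s(k, m)) :
    ∃ D : PlaneDrawing G, (∀ v, D.point v = !₂[pos v, 0]) ∧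
      ∀ (e : G.edgeSet) t, page e = true → 0 ≤ D.arc e t 1 := by
  have hends : ∀ e : G.edgeSet, ∃ u v, (e : Sym2 V) = s(u, v) ∧ pos u < pos v ∧ G.Adj u v := by
    rintro ⟨e, he⟩
    induction e with
    | _ u v =>
      have hadj : G.Adj u v := he
      rcases lt_or_gt_of_ne (hpos.ne hadj.ne) with h | h
      · exact ⟨u, v, rfl, h, hadj⟩
      · exact ⟨v, u, Sym2.eq_swap, h, hadj.symm⟩
  choose l r hlr hlt hadj using hends
  have hzero : ∀ e (t : unitInterval), ((t : ℝ) * (pos (r e) - pos (l e))) *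
      ((1 - t) * (pos (r e) - pos (l e))) = 0 → t = 0 ∨ t = 1 := by
    intro e t h
    have hne : pos (r e) - pos (l e) ≠ 0 := (sub_pos.2 (hlt e)).ne'
    rcases mul_eq_zero.1 h with h | h
    · left
      exact Subtype.ext ((mul_eq_zero.1 h).resolve_right hne)
    · right
      have := (mul_eq_zero.1 h).resolve_right hne
      exact Subtype.ext (by simp only [Set.Icc.coe_one]; linarith)
  let arc : G.edgeSet → C(unitInterval, Plane) := fun e ↦
    parabolaArc (pos (l e)) (pos (r e)) (pageSign (page e))
  have harc0 : ∀ e, arc e 0 = !₂[pos (l e), 0] := by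
    intro e
    apply plane_ext
    · simp [arc, parabolaArc_apply_zero]
    · simp [arc, parabolaArc_apply_one]
  have harc1 : ∀ e, arc e 1 = !₂[pos (r e), 0] := by
    intro e
    apply plane_ext
    · simp [arc, parabolaArc_apply_zero]
    · simp [arc, parabolaArc_apply_one]
  refine ⟨{ point := fun v ↦ !₂[pos v, 0], arc := arc, point_injective := ?_, arc_injective := ?_,
            arc_ends := ?_, arc_vertex := ?_, arc_disjoint := ?_ }, fun v ↦ rfl, ?_⟩
  · intro u v h
    exact hpos (congrArg (fun p : Plane ↦ p 0) h)
  · intro e s t h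
    have h0 : arc e s 0 = arc e t 0 := by rw [h]
    rw [parabolaArc_apply_zero, parabolaArc_apply_zero] at h0
    have h1 := add_left_cancel h0
    exact Subtype.ext (mul_right_cancel₀ (sub_pos.2 (hlt e)).ne' h1)
  · intro e
    rw [harc0, harc1, hlr, Sym2.map_mk]
  · intro e v t h
    have h1 : arc e t 1 = 0 := by
      rw [h]
      rfl
    rw [parabolaArc_apply_one] at h1
    exact hzero e t ((mul_eq_zero.1 h1).resolve_left (pageSign_ne_zero _))
  · intro e f hef s t h
    by_cases hs : s = 0 ∨ s = 1
    · rcases hs with rfl | rfl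
      · exact ⟨l e, harc0 e⟩
      · exact ⟨r e, harc1 e⟩
    by_cases ht : t = 0 ∨ t = 1
    · rw [h]
      rcases ht with rfl | rfl
      · exact ⟨l f, harc0 f⟩
      · exact ⟨r f, harc1 f⟩
    exfalso
    have key : ∀ e (s : unitInterval), ¬ (s = 0 ∨ s = 1) →
        0 < (s : ℝ) * (pos (r e) - pos (l e)) ∧ 0 < (1 - (s : ℝ)) * (pos (r e) - pos (l e)) := by
      intro e s hs
      rw [not_or] at hs
      have h0 : 0 < (s : ℝ) := unitInterval.pos_iff_ne_zero.2 hs.1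
      have h1 : (s : ℝ) < 1 := unitInterval.lt_one_iff_ne_one.2 hs.2
      exact ⟨mul_pos h0 (sub_pos.2 (hlt e)), mul_pos (sub_pos.2 h1) (sub_pos.2 (hlt e))⟩
    have hx : arc e s 0 = arc f t 0 := by rw [h]
    have hy : arc e s 1 = arc f t 1 := by rw [h]
    rw [parabolaArc_apply_zero, parabolaArc_apply_zero] at hx
    rw [parabolaArc_apply_one, parabolaArc_apply_one] at hy
    have he := key e s hs
    have hf := key f t ht
    have hpage : page e = page f := by
      have p1 := mul_pos he.1 he.2
      have p2 := mul_pos hf.1 hf.2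
      cases h1 : page e <;> cases h2 : page f <;> simp only [pageSign, h1, h2] at hy ⊢ <;>
        simp at hy <;> linarith
    rw [hpage] at hy
    have hy := mul_left_cancel₀ (pageSign_ne_zero _) hy
    -- On one page, arcs over a common point are nested. All parabolas have the same leading
    -- coefficient, so with distinct left ends the outer one is strictly higher; equal left ends
    -- would force equal right ends.
    have main : ∀ (e f : G.edgeSet) (x : ℝ), e ≠ f → page e = page f → pos (l e) ≤ pos (l f) →
        pos (l f) < x → x < pos (r e) → x < pos (r f) →
        (x - pos (l e)) * (pos (r e) - x) ≠ (x - pos (l f)) * (pos (r f) - x) := by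
      intro e f x hef hp h1 h2 h3 h4 heq
      rcases h1.lt_or_eq with h1 | h1
      · have h5 : pos (r f) ≤ pos (r e) := by
          by_contra! h5
          refine hcross _ _ _ _ h1 (h2.trans h3) h5 (hadj e) (hadj f) ?_
          rw [← hlr, ← hlr, hp]
        nlinarith [mul_pos (sub_pos.2 h1) (sub_pos.2 h3),
          mul_nonneg (sub_pos.2 h2).le (sub_nonneg.2 h5)]
      · have h5 : pos (r e) = pos (r f) := by
          rw [h1] at heq
          have := mul_left_cancel₀ (sub_pos.2 h2).ne' heq
          linarith
        exact hef (Subtype.ext (by rw [hlr, hlr, hpos h1, hpos h5]))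
    generalize hxe : pos (l e) + s * (pos (r e) - pos (l e)) = x at hx
    have a1 : (s : ℝ) * (pos (r e) - pos (l e)) = x - pos (l e) := by linarith
    have a2 : (1 - (s : ℝ)) * (pos (r e) - pos (l e)) = pos (r e) - x := by linarith
    have a3 : (t : ℝ) * (pos (r f) - pos (l f)) = x - pos (l f) := by linarith
    have a4 : (1 - (t : ℝ)) * (pos (r f) - pos (l f)) = pos (r f) - x := by linarith
    rw [a1, a2, a3, a4] at hy
    rw [a1, a2] at he
    rw [a3, a4] at hf
    rcases le_total (pos (l e)) (pos (l f)) with hle | hle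
    · exact main e f x hef hpage hle (sub_pos.1 hf.1) (sub_pos.1 he.2) (sub_pos.1 hf.2) hy
    · exact main f e x hef.symm hpage.symm hle (sub_pos.1 he.1) (sub_pos.1 hf.2) (sub_pos.1 he.2)
        hy.symm
  · intro e t he
    have h1 : arc e t 1 = _ := parabolaArc_apply_one _ _ _ _
    change 0 ≤ arc e t 1
    rw [h1, he, pageSign, if_pos rfl, one_mul]
    have h2 := (sub_pos.2 (hlt e)).le
    exact mul_nonneg (mul_nonneg t.2.1 h2) (mul_nonneg (sub_nonneg.2 t.2.2) h2)

theorem isPlanar_of_twoPage (pos : V → ℝ) (hpos : Function.Injective pos) (page : Sym2 V → Bool)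
    (hcross : ∀ i k j m, pos i < pos k → pos k < pos j → pos j < pos m → G.Adj i j → G.Adj k m →
      page s(i, j) ≠ page s(k, m)) : IsPlanar G :=
  ⟨(exists_planeDrawing pos hpos page hcross).choose⟩

/-- With all arcs above the line, the open lower half-plane lies in the outer face and has every
vertex in its closure. -/
theorem isOuterplanar_of_onePage (pos : V → ℝ) (hpos : Function.Injective pos)
    (hcross : ∀ i k j m, pos i < pos k → pos k < pos j → pos j < pos m → G.Adj i j → ¬ G.Adj k m) :
    IsOuterplanar G := by
  obtain ⟨D, hpoint, harc⟩ := exists_planeDrawing (G := G) pos hpos (fun _ ↦ true)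
    (fun i k j m h1 h2 h3 h4 h5 ↦ absurd h5 (hcross i k j m h1 h2 h3 h4))
  refine ⟨D, fun v ↦ ?_⟩
  let L : Set Plane := {p | p 1 < 0}
  have hLc : L ⊆ D.carrierᶜ := by
    rintro p hp (⟨u, rfl⟩ | hq)
    · have : D.point u 1 = 0 := by rw [hpoint]; rfl
      exact absurd hp (by simp [L, this])
    · obtain ⟨e, t, rfl⟩ := Set.mem_iUnion.1 hq
      exact absurd hp (not_lt.2 (harc e t rfl))
  have hLconn : IsPreconnected L := by
    refine Convex.isPreconnected ?_
    intro p hp q hq a b ha hb hab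
    simp only [L, Set.mem_ofPred_eq, PiLp.add_apply, PiLp.smul_apply, smul_eq_mul] at hp hq ⊢
    rcases ha.eq_or_lt with rfl | ha
    · rw [zero_add] at hab
      rw [hab]
      linarith
    · nlinarith
  have hLunb : ¬ Bornology.IsBounded L := by
    intro hb
    obtain ⟨R, hR⟩ := hb.exists_norm_le
    have h1 := hR !₂[0, -(|R| + 1)] (by
      simp only [L, Set.mem_ofPred_eq]
      change -(|R| + 1) < 0
      linarith [abs_nonneg R])
    have h2 : |R| + 1 ≤ ‖(!₂[0, -(|R| + 1)] : Plane)‖ := by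
      have := PiLp.norm_apply_le (!₂[0, -(|R| + 1)] : Plane) 1
      have h3 : ‖(!₂[0, -(|R| + 1)] : Plane) 1‖ = |R| + 1 := by
        change ‖-(|R| + 1)‖ = _
        rw [norm_neg, Real.norm_of_nonneg (by positivity)]
      linarith
    linarith [le_abs_self R]
  have hLout : L ⊆ D.outerFace := fun p hp ↦
    ⟨hLc hp, fun hb ↦ hLunb (hb.subset (hLconn.subset_connectedComponentIn hp hLc))⟩
  refine ⟨closure_mono hLout ?_, fun hv ↦ (interior_subset hv).1 (Or.inl ⟨v, rfl⟩)⟩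
  rw [hpoint]
  have hcont : Continuous fun ε : ℝ ↦ (!₂[pos v, -ε] : Plane) := by
    refine (PiLp.continuous_toLp 2 _).comp (continuous_pi fun i ↦ ?_)
    fin_cases i
    · exact continuous_const
    · exact continuous_neg
  have hlim : Filter.Tendsto (fun ε : ℝ ↦ (!₂[pos v, -ε] : Plane)) (nhdsWithin 0 (Set.Ioi 0))
      (nhds !₂[pos v, 0]) := by
    have := (hcont.tendsto 0).mono_left (nhdsWithin_le_nhds (s := Set.Ioi 0))
    simpa using this
  refine mem_closure_of_tendsto hlim ?_
  filter_upwards [self_mem_nhdsWithin] with ε hε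
  change -ε < 0
  exact neg_lt_zero.2 hε

end Drawing

section Ochem

theorem IsNonrepetitive.comp_hom {V W α : Type*} {G : SimpleGraph V} {H : SimpleGraph W} {ψ : V → α}
    (h : IsNonrepetitive G ψ) (f : H →g G) (hf : Function.Injective f) :
    IsNonrepetitive H (ψ ∘ f) := by
  refine isNonrepetitive_of_lists fun A B hA hAB hch hnd ↦
    h.false_of_lists (A := A.map f) (B := B.map f) (by simpa using hA) (by simpa using hAB) ?_ ?_
  · rw [← List.map_append, List.isChain_map]
    exact hch.imp fun a b hab ↦ f.map_adj hab
  · rw [← List.map_append]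
    exact hnd.map hf

/-! ### Planarity of the graph built from `H` -/

section Planar

variable {n : ℕ}

/-- The block of a vertex in the linear order `x, v₁, H₁, v₂, H₂, …, v₂₂, H₂₂, y`. -/
def OchemVertex.block : OchemVertex (Fin n) → ℕ
  | .x => 0
  | .path i => i + 1
  | .copy i _ => i + 1
  | .y => 23

/-- The position of a vertex in its block. -/
def OchemVertex.offset : OchemVertex (Fin n) → ℕ
  | .copy _ w => w + 1
  | _ => 0

/-- The position of a vertex in the linear order `x, v₁, H₁, v₂, H₂, …, v₂₂, H₂₂, y`. -/
def OchemVertex.position (u : OchemVertex (Fin n)) : ℕ := u.block * (n + 1) + u.offset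

theorem OchemVertex.offset_le (u : OchemVertex (Fin n)) : u.offset ≤ n := by
  cases u <;> simp [offset]

theorem OchemVertex.position_lt_iff {u v : OchemVertex (Fin n)} :
    u.position < v.position ↔ u.block < v.block ∨ (u.block = v.block ∧ u.offset < v.offset) := by
  have hu := u.offset_le
  have hv := v.offset_le
  unfold position
  rcases lt_trichotomy u.block v.block with h | h | h
  · have := Nat.mul_le_mul_right (n + 1) (Nat.succ_le_of_lt h)
    rw [Nat.succ_mul] at this
    simp only [h, true_or, iff_true]
    omega
  · rw [h]
    simp
  · have := Nat.mul_le_mul_right (n + 1) (Nat.succ_le_of_lt h)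
    rw [Nat.succ_mul] at this
    simp only [h.not_gt, h.ne', false_and, or_self, iff_false]
    omega

theorem OchemVertex.position_injective :
    Function.Injective (position : OchemVertex (Fin n) → ℕ) := by
  intro u v h
  have h1 : ¬ u.position < v.position := h.not_lt
  have h2 : ¬ v.position < u.position := h.not_gt
  rw [position_lt_iff] at h1 h2
  have hb : u.block = v.block := by omega
  have ho : u.offset = v.offset := by omega
  cases u <;> cases v <;> simp [block, offset] at hb ho ⊢ <;> omega

/-- The edges of `ochemGraph H` from the vertex that comes first. -/
inductive OchemEdge (H : SimpleGraph (Fin n)) : OchemVertex (Fin n) → OchemVertex (Fin n) → Prop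
  | x_y : OchemEdge H .x .y
  | x_path (i : Fin 22) : OchemEdge H .x (.path i)
  | path_y (i : Fin 22) : OchemEdge H (.path i) .y
  | path_path {i j : Fin 22} : (i : ℕ) + 1 = j → OchemEdge H (.path i) (.path j)
  | path_copy (i : Fin 22) (w : Fin n) : OchemEdge H (.path i) (.copy i w)
  | copy_copy (i : Fin 22) {w w' : Fin n} : H.Adj w w' → w < w' →
      OchemEdge H (.copy i w) (.copy i w')

theorem ochemEdge_of_adj {H : SimpleGraph (Fin n)} {u v : OchemVertex (Fin n)}
    (h : (ochemGraph H).Adj u v) (hlt : u.position < v.position) : OchemEdge H u v := by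
  rw [OchemVertex.position_lt_iff] at hlt
  rw [ochemGraph, SimpleGraph.fromRel_adj] at h
  rcases h.2 with h | h <;> cases h with
  | path_path hp =>
    rw [SimpleGraph.pathGraph_adj] at hp
    simp only [OchemVertex.block, OchemVertex.offset] at hlt
    exact .path_path (by omega)
  | x_y => first | exact .x_y | simp [OchemVertex.block, OchemVertex.offset] at hlt
  | x_path i => first | exact .x_path i | simp [OchemVertex.block, OchemVertex.offset] at hlt
  | y_path i =>
    first | exact .path_y i | (simp [OchemVertex.block, OchemVertex.offset] at hlt; omega)
  | path_copy i w => first | exact .path_copy i w | simp [OchemVertex.block, OchemVertex.offset] at hlt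
  | copy_copy i hw =>
    simp only [OchemVertex.block, OchemVertex.offset] at hlt
    first
    | exact .copy_copy i hw (by rw [Fin.lt_def]; omega)
    | exact .copy_copy i hw.symm (by rw [Fin.lt_def]; omega)

/-- The edges on the lower page of a two-page book embedding of `ochemGraph H`. -/
def IsLower (e : Sym2 (OchemVertex (Fin n))) : Prop :=
  (∃ i, e = s(.path i, .y)) ∨ ∃ i w w', e = s(.copy i w, .copy i w')

/-- If `H` has a one-page book embedding, then `ochemGraph H` has a two-page book embedding. -/
theorem isPlanar_ochemGraph {H : SimpleGraph (Fin n)}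
    (hH : ∀ i k j m : Fin n, i < k → k < j → j < m → H.Adj i j → ¬ H.Adj k m) :
    IsPlanar (ochemGraph H) := by
  classical
  refine isPlanar_of_twoPage (fun u ↦ (u.position : ℝ))
    (Nat.cast_injective.comp OchemVertex.position_injective) (fun e ↦ decide (IsLower e)) ?_
  intro i k j m hik hkj hjm hij hkm
  have hik := Nat.cast_lt.1 hik
  have hkj := Nat.cast_lt.1 hkj
  have hjm := Nat.cast_lt.1 hjm
  have e1 := ochemEdge_of_adj hij (hik.trans hkj)
  have e2 := ochemEdge_of_adj hkm (hkj.trans hjm)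
  rw [OchemVertex.position_lt_iff] at hik hkj hjm
  rw [Ne, decide_eq_decide]
  cases e1 <;> cases e2 <;> simp [IsLower, OchemVertex.block, OchemVertex.offset] at * <;> try omega
  -- A spoke from `v_i` to `H_i` may cross an edge of `H_i`, but the two lie on different pages.
  case path_copy.copy_copy => exact ⟨_, _, _, fun h ↦ absurd rfl (h rfl rfl rfl)⟩
  case copy_copy.copy_copy _ _ _ h1 _ _ _ _ h2 _ _ _ _ =>
    exact absurd h2 (hH _ _ _ _ (by omega) (by omega) (by omega) h1)

end Planar

/-! ### Ten colours do not suffice for that graph -/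

section LowerBound

variable {W : Type*} {H : SimpleGraph W}

/-- The inclusion of a copy of `H` in `ochemGraph H`. -/
def copyHom (H : SimpleGraph W) (i : Fin 22) : H →g ochemGraph H where
  toFun := .copy i
  map_rel' h := (SimpleGraph.fromRel_adj _ _ _).2
    ⟨by simpa using h.ne, Or.inl (.copy_copy i h)⟩

theorem ochemGraph_adj_x_path (i : Fin 22) : (ochemGraph H).Adj .x (.path i) :=
  (SimpleGraph.fromRel_adj _ _ _).2 ⟨by simp, Or.inl (.x_path i)⟩

theorem ochemGraph_adj_y_path (i : Fin 22) : (ochemGraph H).Adj .y (.path i) :=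
  (SimpleGraph.fromRel_adj _ _ _).2 ⟨by simp, Or.inl (.y_path i)⟩

theorem ochemGraph_adj_x_y : (ochemGraph H).Adj .x .y :=
  (SimpleGraph.fromRel_adj _ _ _).2 ⟨by simp, Or.inl .x_y⟩

theorem ochemGraph_adj_path_copy (i : Fin 22) (w : W) : (ochemGraph H).Adj (.path i) (.copy i w) :=
  (SimpleGraph.fromRel_adj _ _ _).2 ⟨by simp, Or.inl (.path_copy i w)⟩

theorem ochemGraph_adj_path_path {i j : Fin 22} (h : (i : ℕ) + 1 = j) :
    (ochemGraph H).Adj (.path i) (.path j) :=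
  (SimpleGraph.fromRel_adj _ _ _).2 ⟨by
    simp only [ne_eq, OchemVertex.path.injEq]
    rintro rfl
    omega, Or.inl (.path_path (SimpleGraph.pathGraph_adj.2 (Or.inl h)))⟩

theorem IsNonrepetitive.ne_of_adj {V α : Type*} {G : SimpleGraph V} {ψ : V → α}
    (h : IsNonrepetitive G ψ) {u v : V} (huv : G.Adj u v) : ψ u ≠ ψ v := fun he ↦
  h.false_of_lists (A := [u]) (B := [v]) (by simp) (by simp [he]) (by simpa using huv)
    (by simpa using huv.ne)

theorem IsNonrepetitive.false_of_four {V α : Type*} {G : SimpleGraph V} {ψ : V → α}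
    (h : IsNonrepetitive G ψ) {a b c d : V} (hab : G.Adj a b) (hbc : G.Adj b c) (hcd : G.Adj c d)
    (hac : a ≠ c) (had : a ≠ d) (hbd : b ≠ d) (h1 : ψ a = ψ c) (h2 : ψ b = ψ d) : False :=
  h.false_of_lists (A := [a, b]) (B := [c, d]) (by simp) (by simp [h1, h2]) (by simp [*])
    (by simp [*, hab.ne, hbc.ne, hcd.ne])

theorem eleven_le_nonrepChromaticNumber_ochemGraph [Fintype W]
    (hH : 7 ≤ nonrepChromaticNumber H) : 11 ≤ nonrepChromaticNumber (ochemGraph H) := by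
  classical
  refine le_nonrepChromaticNumber (k := 10) fun ψ hψ ↦ ?_
  have hcard : ∀ i, 6 < (Finset.univ.image (ψ ∘ copyHom H i)).card := fun i ↦
    lt_card_image_of_lt (k := 6) hH
      (hψ.comp_hom _ fun u v h ↦ (OchemVertex.copy.inj h).2)
  -- If `H_i` used the colour of `x`, the path through `v_i`, `x`, `v_j` would be repetitive;
  -- likewise for `y`. Missing one further colour `a` would leave only six of the ten.
  have hrep : ∀ i j, i ≠ j → ψ (.path i) = ψ (.path j) → ∀ a, a ≠ ψ .x → a ≠ ψ .y →
      a ≠ ψ (.path i) → ∃ w, ψ (.copy i w) = a := by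
    intro i j hij hc a hax hay hai
    by_contra! ha
    have hsub : Finset.univ.image (ψ ∘ copyHom H i) ⊆
        Finset.univ \ {a, ψ .x, ψ .y, ψ (.path i)} := by
      intro b hb
      obtain ⟨w, -, rfl⟩ := Finset.mem_image.1 hb
      simp only [Finset.mem_sdiff, Finset.mem_univ, true_and, Finset.mem_insert,
        Finset.mem_singleton, not_or]
      refine ⟨ha w, fun h ↦ ?_, fun h ↦ ?_, (hψ.ne_of_adj (ochemGraph_adj_path_copy i w)).symm⟩
      · exact hψ.false_of_four (ochemGraph_adj_path_copy i w).symm (ochemGraph_adj_x_path i).symm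
          (ochemGraph_adj_x_path j) (by simp) (by simp) (by simpa using hij) h hc
      · exact hψ.false_of_four (ochemGraph_adj_path_copy i w).symm (ochemGraph_adj_y_path i).symm
          (ochemGraph_adj_y_path j) (by simp) (by simp) (by simpa using hij) h hc
    have h1 := Finset.card_le_card hsub
    have h2 : ({a, ψ .x, ψ .y, ψ (.path i)} : Finset (Fin 10)).card = 4 := by
      have h3 := hψ.ne_of_adj (ochemGraph_adj_x_y (H := H))
      have h4 := hψ.ne_of_adj (ochemGraph_adj_x_path (H := H) i)
      have h5 := hψ.ne_of_adj (ochemGraph_adj_y_path (H := H) i)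
      simp [hax, hay, hai, h3, h4, h5]
    rw [Finset.card_sdiff_of_subset (Finset.subset_univ _), h2, Finset.card_univ,
      Fintype.card_fin] at h1
    have := hcard i
    omega
  -- If both vertices of a consecutive pair had repeated colours, each copy would contain the colour
  -- of the other path vertex, closing a square of length four.
  have hpair : ∀ l : Fin 11, ∃ i : Fin 22, (i : ℕ) / 2 = l ∧
      ∀ j, i ≠ j → ψ (.path i) ≠ ψ (.path j) := by
    intro l
    by_contra! hl
    obtain ⟨i', hi', ci⟩ := hl ⟨2 * l, by omega⟩ (by simp)
    obtain ⟨j', hj', cj⟩ := hl ⟨2 * l + 1, by omega⟩ (by simp; omega)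
    generalize hi : (⟨2 * l, by omega⟩ : Fin 22) = i at *
    generalize hj : (⟨2 * l + 1, by omega⟩ : Fin 22) = j at *
    have hadj : (ochemGraph H).Adj (.path i) (.path j) :=
      ochemGraph_adj_path_path (by rw [← hi, ← hj])
    have hne := hψ.ne_of_adj hadj
    obtain ⟨w, hw⟩ := hrep i i' hi' ci (ψ (.path j))
      (hψ.ne_of_adj (ochemGraph_adj_x_path j)).symm (hψ.ne_of_adj (ochemGraph_adj_y_path j)).symm
      hne.symm
    obtain ⟨w', hw'⟩ := hrep j j' hj' cj (ψ (.path i))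
      (hψ.ne_of_adj (ochemGraph_adj_x_path i)).symm (hψ.ne_of_adj (ochemGraph_adj_y_path i)).symm
      hne
    have hij : i ≠ j := by
      rintro rfl
      exact hadj.ne rfl
    exact hψ.false_of_four (ochemGraph_adj_path_copy i w).symm hadj (ochemGraph_adj_path_copy j w')
      (by simp) (by simp [hij]) (by simp) hw hw'.symm
  choose u hu hinj using hpair
  have hg : Function.Injective fun l ↦ ψ (.path (u l)) := by
    intro l l' h
    by_contra hne
    refine hinj l (u l') ?_ h
    intro h'
    exact hne (Fin.ext (by rw [← hu, ← hu, h']))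
  have := Fintype.card_le_of_injective _ hg
  simp at this

end LowerBound

end Ochem

/-- There is a graph with a one-page book embedding that has no nonrepetitive `6`-colouring. -/
theorem exists_onePage_seven_le : ∃ (n : ℕ) (H : SimpleGraph (Fin n)),
    (∀ i k j m : Fin n, i < k → k < j → j < m → H.Adj i j → ¬ H.Adj k m) ∧
      7 ≤ nonrepChromaticNumber H := by
  obtain ⟨s, hs⟩ := exists_finset_not_isNonrepetitive (by norm_num)
    not_isNonrepetitive_siblingTree
  refine ⟨s.card, _, fun i k j m hik hkj hjm hij hkm ↦ ?_, le_nonrepChromaticNumber (k := 6) hs⟩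
  have hmono := (s.orderEmbOfFin rfl).strictMono
  exact siblingTree_not_crossing (hmono hik) (hmono hkj) (hmono hjm) hij hkm

end Nonrepetitive

theorem mainTheorem7 :
    (∃ (n : ℕ) (H : SimpleGraph (Fin n)),
      Nonrepetitive.IsOuterplanar H ∧
      7 ≤ Nonrepetitive.nonrepChromaticNumber H ∧
      Nonrepetitive.IsPlanar (Nonrepetitive.ochemGraph H) ∧
      11 ≤ Nonrepetitive.nonrepChromaticNumber (Nonrepetitive.ochemGraph H)) ∧
    ∀ (n : ℕ) (H : SimpleGraph (Fin n)),
      7 ≤ Nonrepetitive.nonrepChromaticNumber H →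
        11 ≤ Nonrepetitive.nonrepChromaticNumber (Nonrepetitive.ochemGraph H) := by
  obtain ⟨n, H, hcross, h7⟩ := Nonrepetitive.exists_onePage_seven_le
  refine ⟨⟨n, H, ?_, h7, Nonrepetitive.isPlanar_ochemGraph hcross,
    Nonrepetitive.eleven_le_nonrepChromaticNumber_ochemGraph h7⟩,
    fun n H h ↦ Nonrepetitive.eleven_le_nonrepChromaticNumber_ochemGraph h⟩
  refine Nonrepetitive.isOuterplanar_of_onePage (fun i ↦ ((i : ℕ) : ℝ))
    (Nat.cast_injective.comp Fin.val_injective) fun i k j m hik hkj hjm ↦ ?_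
  exact hcross i k j m (Nat.cast_lt.1 hik) (Nat.cast_lt.1 hkj) (Nat.cast_lt.1 hjm)
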